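/- Let $n\ge 1$ guests be seated, one at a time and in uniformly random order, at a circular table with $n$ places and $n$ napkins, exactly one napkin between any two neighbouring places (if $n=1$, the single napkin lies on both sides of the single place). Let $p,q>0$ with $p+q=1$. Independently of each other and of the seating order, each guest prefers the napkin on his left with probability $p$ and the napkin on his right with probability $q$. When a guest sits down, he takes the napkin he prefers if it is still available; otherwise he takes the other adjacent napkin if that one is still available; otherwise he gets no napkin and is called napkinless. Let $E_n$ be the expected number of napkinless guests after everyone has been seated. Equivalently, $$E_n=\frac1{n!}\sum_{\pi} p^{|\pi|_-}q^{|\pi|_+}\,o(\pi),$$ where $\pi$ ranges over the signed permutations of $\{1,\dots,n\}$ (the absolute value of the $i$-th entry is the rank in the seating order of the guest at place $i$, and its sign is $-$ if he prefers left and $+$ if he prefers right), $|\pi|_-$ and $|\pi|_+$ are the numbers of negative and positive entries, and $o(\pi)$ is the resulting number of napkinless guests. **Corollary (Sudbury's asymptotic).** One has $$E_n=\frac{n(1-pe^{q})(1-qe^{p})}{pq}+O\!\left(\frac1{n!}\right),$$ where the implied constant is absolute: there is a constant $C$ such that for all such $p,q$ and all $n\ge1$ the difference between $E_n$ and the main term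 is at most $C/n!$ in absolute value. In particular, when $p=q=\tfrac12$, $$E_n=n(2-\sqrt e)^2+O\!\left(\frac1{n!}\right).$$ -/

import Mathlib

open scoped Nat

namespace NapkinProblem

/-- A signed permutation of `[n]`, describing how the `n` guests at a table are seated.
The places are the elements of `Fin n`, in counter-clockwise order. The guest at place `i` is
the `order i`-th one to sit down (counting from `0`), and `sign i` is the sign of the `i`-th
entry: `true` (plus) if he prefers the right napkin, `false` (minus) if he prefers the left one. -/
structure SignedPerm (n : ℕ) where
  order : Equiv.Perm (Fin n)
  sign : Fin n → Bool

/-- Signed permutations are pairs of a permutation and a sign vector. -/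
def SignedPerm.equivProd (n : ℕ) : SignedPerm n ≃ Equiv.Perm (Fin n) × (Fin n → Bool) where
  toFun π := (π.order, π.sign)
  invFun x := ⟨x.1, x.2⟩
  left_inv _ := rfl
  right_inv _ := rfl

instance (n : ℕ) : Fintype (SignedPerm n) := Fintype.ofEquiv _ (SignedPerm.equivProd n).symm

/-- There are `n` napkins, one between any two neighbouring places of the circular table.
Napkin `i` lies immediately to the left of place `i`. -/
def leftNapkin {n : ℕ} (i : Fin n) : Fin n := i

/-- The napkin to the right of place `i` is the one to the left of place `i + 1` (modulo `n`). -/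
def rightNapkin {n : ℕ} (i : Fin n) : Fin n := finRotate n i

/-- The napkin that the guest at place `i` prefers. -/
def SignedPerm.preferred {n : ℕ} (π : SignedPerm n) (i : Fin n) : Fin n :=
  if π.sign i then rightNapkin i else leftNapkin i

/-- The other napkin adjacent to place `i`. -/
def SignedPerm.other {n : ℕ} (π : SignedPerm n) (i : Fin n) : Fin n :=
  if π.sign i then leftNapkin i else rightNapkin i

/-- What the guest at place `i` takes if `A` is the set of napkins on the table when he sits
down: the preferred napkin if present, else the other one if present, else nothing. -/
def SignedPerm.take {n : ℕ} (π : SignedPerm n) (A : Finset (Fin n)) (i : Fin n) :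
    Option (Fin n) :=
  if π.preferred i ∈ A then some (π.preferred i)
  else if π.other i ∈ A then some (π.other i)
  else none

/-- The set of napkins left on the table after the first `t` guests have sat down. -/
def SignedPerm.onTable {n : ℕ} (π : SignedPerm n) : ℕ → Finset (Fin n)
  | 0 => Finset.univ
  | t + 1 =>
    if h : t < n then
      match π.take (π.onTable t) (π.order.symm ⟨t, h⟩) with
      | some k => (π.onTable t).erase k
      | none => π.onTable t
    else π.onTable t

/-- The napkin, if any, that the guest at place `i` gets. -/
def SignedPerm.napkinOf {n : ℕ} (π : SignedPerm n) (i : Fin n) : Option (Fin n) :=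
  π.take (π.onTable (π.order i)) i

/-- The statistic `o(π)`: the number of guests who end up without a napkin. -/
def SignedPerm.numNapkinless {n : ℕ} (π : SignedPerm n) : ℕ :=
  (Finset.univ.filter fun i => π.napkinOf i = none).card

/-- The number of negative entries, that is, of guests who prefer the left napkin. -/
def SignedPerm.numNeg {n : ℕ} (π : SignedPerm n) : ℕ :=
  (Finset.univ.filter fun i => π.sign i = false).card

/-- The number of positive entries, that is, of guests who prefer the right napkin. -/
def SignedPerm.numPos {n : ℕ} (π : SignedPerm n) : ℕ :=
  (Finset.univ.filter fun i => π.sign i = true).card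

/-- The expected number of napkinless guests at a circular table for `n`, when the seating order
is uniformly random and each guest independently prefers the left napkin with probability `p`
and the right napkin with probability `q`: the signed permutation `π` has probability
`p ^ π.numNeg * q ^ π.numPos / n!`. -/
noncomputable def expectedNapkinless (p q : ℝ) (n : ℕ) : ℝ :=
  ∑ π : SignedPerm n, p ^ π.numNeg * q ^ π.numPos / (n ! : ℝ) * (π.numNapkinless : ℝ)

end NapkinProblem

/-! The napkin to the left of a place can only be lost to the left-hand neighbour. He must have sat
down earlier, and either he preferred his right napkin or his own left napkin was already gone.
Iterating (`leftGone_succ_iff`, `iff_exists_isChain`) gives a chain of earlier and earlier guests to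
the left, all preferring left except the last, who prefers right. The other side is the mirror
image, so a guest is napkinless exactly when both chains exist (`napkinOf_eq_none_iff_isChain`).
Their lengths `k, l ≥ 1` are unique and `k + l < n`.

For fixed `k, l`, the signs have probability `(p^(k-1) q)(q^(l-1) p) = p^k q^l`. The order has
probability `1 / ((k+l+1) k! l!)`: the guest is last among `k + l + 1`, and each arm is in one
prescribed order. Summing over `k + l = m` by the binomial theorem gives the exact formula
`expectedNapkinless_eq`, `n` times a partial sum of a series. The full series has the stated closed
form, and its tail past `n` is at most `e / (n+1)!` (`napkin_series_bound`), which yields the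
constant `e`. -/

namespace NapkinProblem

open Finset

/-! ### Counting orders and weighing sign vectors -/

section Counting

theorem exists_unique_strictAnti {α : Type*} [LinearOrder α] {k : ℕ} {f : Fin k → α}
    (hf : Function.Injective f) : ∃! τ : Equiv.Perm (Fin k), StrictAnti (f ∘ τ) := by
  have hf' : Function.Injective (OrderDual.toDual ∘ f) := hf
  refine ⟨Tuple.sort (OrderDual.toDual ∘ f), ?_, ?_⟩
  · have h := (Tuple.monotone_sort (OrderDual.toDual ∘ f)).strictMono_of_injective
      (hf'.comp (Equiv.injective _))
    exact fun a b hab => h hab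
  · intro τ hτ
    have h := Tuple.unique_monotone (f := OrderDual.toDual ∘ f) (σ := τ)
      (τ := Tuple.sort (OrderDual.toDual ∘ f)) (fun a b hab => hτ.antitone hab)
      (Tuple.monotone_sort _)
    exact Equiv.coe_fn_injective (hf'.comp_left h)

/-- Among the permutations satisfying a condition that is insensitive to permuting the points
`v 0, …, v (k - 1)`, exactly one in `k!` is decreasing along `v`. -/
theorem card_strictAnti_mul_factorial {n k : ℕ} (v : Fin k ↪ Fin n)
    (P : Equiv.Perm (Fin n) → Prop) [DecidablePred P]
    (hP : ∀ σ τ : Equiv.Perm (Fin n), (∀ x ∉ Set.range v, τ x = x) → P σ → P (σ * τ)) :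
    #{σ : Equiv.Perm (Fin n) | P σ ∧ StrictAnti (σ ∘ v)} * k ! =
      #{σ : Equiv.Perm (Fin n) | P σ} := by
  classical
  have hext : ∀ (τ : Equiv.Perm (Fin k)) (x : Fin k),
      τ.viaFintypeEmbedding v (v x) = v (τ x) := fun τ x =>
    Equiv.Perm.viaFintypeEmbedding_apply_image τ v x
  have hfix : ∀ (τ : Equiv.Perm (Fin k)), ∀ x ∉ Set.range v,
      τ.viaFintypeEmbedding v x = x := fun τ x hx =>
    Equiv.Perm.viaFintypeEmbedding_apply_notMem_range τ v hx
  have hfiber : ∀ τ : Equiv.Perm (Fin k),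
      #{σ : Equiv.Perm (Fin n) | P σ ∧ StrictAnti (σ ∘ v ∘ τ)} =
        #{σ : Equiv.Perm (Fin n) | P σ ∧ StrictAnti (σ ∘ v)} := by
    intro τ
    refine card_bij' (fun σ _ => σ * τ.viaFintypeEmbedding v)
      (fun σ _ => σ * (τ.viaFintypeEmbedding v)⁻¹) ?_ ?_ ?_ ?_
    · intro σ hσ
      simp only [mem_filter, mem_univ, true_and] at hσ ⊢
      refine ⟨hP _ _ (hfix τ) hσ.1, ?_⟩
      convert hσ.2 using 1
      funext x
      simp [hext]
    · intro σ hσ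
      simp only [mem_filter, mem_univ, true_and] at hσ ⊢
      refine ⟨hP _ _ (fun x hx => ?_) hσ.1, ?_⟩
      · rw [Equiv.Perm.inv_eq_iff_eq, hfix τ x hx]
      · convert hσ.2 using 1
        funext x
        have h : (τ.viaFintypeEmbedding v)⁻¹ (v (τ x)) = v x := by
          rw [Equiv.Perm.inv_eq_iff_eq, hext]
        exact congrArg σ h
    · intro σ _; simp
    · intro σ _; simp
  have h1 : #{σ : Equiv.Perm (Fin n) | P σ} =
      ∑ τ : Equiv.Perm (Fin k), #{σ : Equiv.Perm (Fin n) | P σ ∧ StrictAnti (σ ∘ v ∘ τ)} := by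
    simp only [card_filter]
    rw [sum_comm]
    refine sum_congr rfl fun σ _ => ?_
    obtain ⟨τ, hτ, huniq⟩ := exists_unique_strictAnti (σ.injective.comp v.injective)
    rw [sum_eq_single τ]
    · by_cases h : P σ
      · rw [if_pos h, if_pos ⟨h, hτ⟩]
      · simp [h]
    · intro τ' _ hne
      exact if_neg fun h => hne (huniq τ' h.2)
    · simp
  rw [h1, sum_congr rfl fun τ _ => hfiber τ, sum_const, card_univ, Fintype.card_perm,
    Fintype.card_fin, smul_eq_mul, mul_comm]

/-- Each of the points of `S` is equally likely to be where a permutation is largest on `S`. -/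
theorem card_isMax_mul_card {n : ℕ} {S : Finset (Fin n)} {i : Fin n} (hi : i ∈ S) :
    #{σ : Equiv.Perm (Fin n) | ∀ x ∈ S, σ x ≤ σ i} * #S = n ! := by
  have hfiber : ∀ y ∈ S, #{σ : Equiv.Perm (Fin n) | ∀ x ∈ S, σ x ≤ σ y} =
      #{σ : Equiv.Perm (Fin n) | ∀ x ∈ S, σ x ≤ σ i} := by
    intro y hy
    have hS : ∀ x ∈ S, Equiv.swap i y x ∈ S := by
      intro x hx
      rw [Equiv.swap_apply_def]
      split_ifs <;> assumption
    refine card_bij' (fun σ _ => σ * Equiv.swap i y) (fun σ _ => σ * Equiv.swap i y)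
      ?_ ?_ ?_ ?_
    · intro σ hσ
      simp only [mem_filter, mem_univ, true_and] at hσ ⊢
      intro x hx
      simpa using hσ _ (hS x hx)
    · intro σ hσ
      simp only [mem_filter, mem_univ, true_and] at hσ ⊢
      intro x hx
      simpa using hσ _ (hS x hx)
    · intro σ _; simp [mul_assoc]
    · intro σ _; simp [mul_assoc]
  have h1 : ∑ y ∈ S, #{σ : Equiv.Perm (Fin n) | ∀ x ∈ S, σ x ≤ σ y} = n ! := by
    simp only [card_filter]
    rw [sum_comm]
    trans ∑ σ : Equiv.Perm (Fin n), 1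
    · refine sum_congr rfl fun σ _ => ?_
      obtain ⟨y, hy, hmax⟩ := S.exists_max_image σ ⟨i, hi⟩
      rw [sum_eq_single_of_mem y hy, if_pos hmax]
      intro z hz hne
      exact if_neg fun h => hne (σ.injective (le_antisymm (hmax z hz) (h y hy)))
    · rw [sum_const, card_univ, Fintype.card_perm, Fintype.card_fin, smul_eq_mul, mul_one]
  rw [← h1, sum_congr rfl hfiber, sum_const, smul_eq_mul, mul_comm]

/-- The total weight of the sign vectors with prescribed signs in some places. -/
theorem sum_sign_weight {n : ℕ} (p q : ℝ) (hpq : p + q = 1) (A B : Finset (Fin n))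
    (hAB : Disjoint A B) :
    ∑ s : Fin n → Bool, (if (∀ x ∈ A, s x = false) ∧ ∀ x ∈ B, s x = true then
      p ^ #{i | s i = false} * q ^ #{i | s i = true} else 0) = p ^ #A * q ^ #B := by
  -- The weight and the constraint both factor over places, so the sum becomes a product of sums
  -- over one sign each; a free place contributes `p + q = 1`.
  let g : Fin n → Bool → ℝ := fun x b =>
    if (x ∈ A → b = false) ∧ (x ∈ B → b = true) then (if b then q else p) else 0
  have h1 : ∀ s : Fin n → Bool, (if (∀ x ∈ A, s x = false) ∧ ∀ x ∈ B, s x = true then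
      p ^ #{i | s i = false} * q ^ #{i | s i = true} else 0) = ∏ x, g x (s x) := by
    intro s
    split_ifs with h
    · have : ∀ x, g x (s x) = (if s x = false then p else 1) * (if s x = true then q else 1) := by
        intro x
        have hx : (x ∈ A → s x = false) ∧ (x ∈ B → s x = true) := ⟨h.1 x, h.2 x⟩
        simp only [g, if_pos hx]
        cases s x <;> simp
      simp only [this, prod_mul_distrib, prod_ite, prod_const, one_pow, mul_one]
    · symm
      have : ∃ x, ¬((x ∈ A → s x = false) ∧ (x ∈ B → s x = true)) := by
        by_contra! hc
        exact h ⟨fun x hx => (hc x).1 hx, fun x hx => (hc x).2 hx⟩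
      obtain ⟨x, hx⟩ := this
      exact prod_eq_zero (mem_univ x) (if_neg hx)
  have h2 : ∀ x, ∑ b, g x b = (if x ∈ A then p else 1) * (if x ∈ B then q else 1) := by
    intro x
    have : x ∈ A → x ∉ B := fun h => Finset.disjoint_left.mp hAB h
    by_cases hA : x ∈ A <;> by_cases hB : x ∈ B <;> simp_all [g, add_comm]
  rw [sum_congr rfl fun s _ => h1 s, ← Fintype.prod_sum, prod_congr rfl fun x _ => h2 x]
  rw [prod_mul_distrib]
  simp

end Counting

/-! ### The series and its tail -/

section Analysis

theorem hasSum_pow_div_factorial_succ {x : ℝ} (hx : x ≠ 0) :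
    HasSum (fun m : ℕ => x ^ m / ((m + 1)! : ℝ)) ((Real.exp x - 1) / x) := by
  have h : HasSum (fun m : ℕ => x ^ m / (m ! : ℝ)) (Real.exp x) := by
    rw [Real.exp_eq_exp_ℝ]
    exact NormedSpace.expSeries_div_hasSum_exp x
  have h' := (hasSum_nat_add_iff' 1).mpr h
  have h'' := h'.div_const x
  simp only [sum_range_one, pow_zero, Nat.factorial_zero, Nat.cast_one, div_one] at h''
  refine h''.congr_fun fun m => ?_
  rw [pow_succ]
  field_simp

/-- Binomial expansion of `(p + q)^m = 1` without its two extreme terms. For `m = 0` these coincide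
and would be subtracted twice, hence the correction. -/
theorem sum_antidiagonal_pos {p q : ℝ} (hpq : p + q = 1) (m : ℕ) :
    ∑ x ∈ antidiagonal m, (if 1 ≤ x.1 ∧ 1 ≤ x.2 then
      p ^ x.1 * q ^ x.2 / ((m + 1) * x.1 ! * x.2 ! : ℝ) else 0) =
    (1 - p ^ m - q ^ m + if m = 0 then 1 else 0) / ((m + 1)! : ℝ) := by
  rcases eq_or_ne m 0 with rfl | hm
  · simp
  set t : ℕ × ℕ → ℝ := fun x => p ^ x.1 * q ^ x.2 / (x.1 ! * x.2 ! : ℝ) with ht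
  have hbin : ∑ x ∈ antidiagonal m, t x = 1 / (m ! : ℝ) := by
    have h := Commute.add_pow' (Commute.all p q) m
    rw [hpq, one_pow] at h
    rw [h, sum_div]
    refine sum_congr rfl fun x hx => ?_
    rw [HasAntidiagonal.mem_antidiagonal] at hx
    rw [← hx, nsmul_eq_mul, Nat.cast_add_choose]
    have := Nat.factorial_ne_zero (x.1 + x.2)
    simp only [ht]
    field_simp
  have hterm : ∀ x ∈ antidiagonal m, (if 1 ≤ x.1 ∧ 1 ≤ x.2 then
      p ^ x.1 * q ^ x.2 / ((m + 1) * x.1 ! * x.2 ! : ℝ) else 0) =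
      (t x - (if x = (m, 0) then t x else 0) - (if x = (0, m) then t x else 0)) / (m + 1) := by
    rintro ⟨a, b⟩ hx
    rw [HasAntidiagonal.mem_antidiagonal] at hx
    simp only [Prod.mk.injEq]
    rcases eq_or_ne a 0 with rfl | ha
    · have : b = m := by simpa using hx
      simp [this, hm, hm.symm]
    rcases eq_or_ne b 0 with rfl | hb
    · have : a = m := by simpa using hx
      simp [this, hm]
    rw [if_pos (by omega), if_neg (by simp [hb]), if_neg (by simp [ha]), sub_zero,
      sub_zero, ht, div_div]
    ring
  rw [sum_congr rfl hterm, ← sum_div, sum_sub_distrib, sum_sub_distrib, hbin, sum_ite_eq',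
    sum_ite_eq', if_pos (by simp), if_pos (by simp), if_neg hm, Nat.factorial_succ]
  simp only [ht]
  push_cast
  have := Nat.factorial_ne_zero m
  field_simp
  simp

theorem napkin_series_bound {p q : ℝ} (hp : 0 < p) (hq : 0 < q) (hpq : p + q = 1) (n : ℕ) :
    |n * ∑ m ∈ range n, (1 - p ^ m - q ^ m + if m = 0 then 1 else 0) / ((m + 1)! : ℝ) -
      n * (1 - p * Real.exp q) * (1 - q * Real.exp p) / (p * q)| ≤ Real.exp 1 / (n ! : ℝ) := by
  set f : ℕ → ℝ := fun m => (1 - p ^ m - q ^ m + if m = 0 then 1 else 0) / ((m + 1)! : ℝ) with hf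
  have hsum : HasSum f ((1 - p * Real.exp q) * (1 - q * Real.exp p) / (p * q)) := by
    have h1 := hasSum_pow_div_factorial_succ one_ne_zero
    have hp1 := hasSum_pow_div_factorial_succ hp.ne'
    have hq1 := hasSum_pow_div_factorial_succ hq.ne'
    have h0 := hasSum_ite_eq (0 : ℕ) (1 : ℝ)
    have h := ((h1.sub hp1).sub hq1).add h0
    have hval : (Real.exp 1 - 1) / 1 - (Real.exp p - 1) / p - (Real.exp q - 1) / q + 1 =
        (1 - p * Real.exp q) * (1 - q * Real.exp p) / (p * q) := by
      have : Real.exp 1 = Real.exp p * Real.exp q := by rw [← Real.exp_add, hpq]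
      rw [this]
      obtain rfl : q = 1 - p := by linarith
      have := hq.ne'
      field_simp
      ring
    rw [hval] at h
    refine h.congr_fun fun m => ?_
    simp only [hf, one_pow]
    split_ifs with h
    · subst h; simp
    · ring
  have hbound : ∀ m, |f (m + n)| ≤ 1 / ((n + 1)! : ℝ) * (1 ^ m / (m ! : ℝ)) := by
    intro m
    have hp1 : p ≤ 1 := by linarith
    have hq1 : q ≤ 1 := by linarith
    have hnum : |1 - p ^ (m + n) - q ^ (m + n) + if m + n = 0 then 1 else 0| ≤ 1 := by
      split_ifs with h
      · rw [h]; simp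
      · have := pow_le_of_le_one hp.le hp1 h
        have := pow_le_of_le_one hq.le hq1 h
        have := pow_pos hp (m + n)
        have := pow_pos hq (m + n)
        rw [abs_le]; constructor <;> linarith
    -- This dominates the tail by `1 / (n+1)!` times the exponential series at `1`.
    have hfac : ((n + 1)! : ℝ) * m ! ≤ ((m + n + 1)! : ℝ) := by
      have := Nat.le_of_dvd (Nat.factorial_pos _) (Nat.factorial_mul_factorial_dvd_factorial_add (n + 1) m)
      rw [show m + n + 1 = n + 1 + m by ring]
      exact_mod_cast this
    rw [hf, abs_div, Nat.abs_cast, one_pow, div_mul_div_comm, one_mul]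
    gcongr
  have hexp : HasSum (fun m : ℕ => 1 / ((n + 1)! : ℝ) * (1 ^ m / (m ! : ℝ)))
      (1 / ((n + 1)! : ℝ) * Real.exp 1) := by
    rw [Real.exp_eq_exp_ℝ]
    exact (NormedSpace.expSeries_div_hasSum_exp (1 : ℝ)).mul_left _
  have htail := (hasSum_nat_add_iff' n).mpr hsum
  have h : |(1 - p * Real.exp q) * (1 - q * Real.exp p) / (p * q) - ∑ m ∈ range n, f m| ≤
      1 / ((n + 1)! : ℝ) * Real.exp 1 := by
    rw [← htail.tsum_eq, ← Real.norm_eq_abs]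
    exact tsum_of_norm_bounded hexp hbound
  calc _ = n * |(1 - p * Real.exp q) * (1 - q * Real.exp p) / (p * q) - ∑ m ∈ range n, f m| := by
        rw [abs_sub_comm, ← Nat.abs_cast n, ← abs_mul, Nat.abs_cast]
        congr 1; ring
    _ ≤ (n + 1) * (1 / ((n + 1)! : ℝ) * Real.exp 1) := by gcongr; linarith
    _ = Real.exp 1 / (n ! : ℝ) := by
        rw [Nat.factorial_succ]; push_cast; field_simp

end Analysis

/-! ### From the seating process to chains -/

section Dynamics

variable {N : ℕ} (π : SignedPerm (N + 1))

theorem rightNapkin_eq (i : Fin (N + 1)) : rightNapkin i = i + 1 := finRotate_apply i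

theorem SignedPerm.mem_onTable_iff (t : ℕ) (ht : t ≤ N + 1) (c : Fin (N + 1)) :
    c ∈ π.onTable t ↔ ∀ j, (π.order j : ℕ) < t → π.napkinOf j ≠ some c := by
  induction t with
  | zero => simp [SignedPerm.onTable]
  | succ t ih =>
    have ht' : t < N + 1 := ht
    have hstep : c ∈ π.onTable (t + 1) ↔
        c ∈ π.onTable t ∧ π.napkinOf (π.order.symm ⟨t, ht'⟩) ≠ some c := by
      rw [SignedPerm.onTable, dif_pos ht', SignedPerm.napkinOf, Equiv.apply_symm_apply]
      cases h : π.take (π.onTable t) (π.order.symm ⟨t, ht'⟩) with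
      | none => simp
      | some d => simp [mem_erase, and_comm, eq_comm]
    rw [hstep, ih ht'.le]
    constructor
    · rintro ⟨h1, h2⟩ j hj
      rcases Nat.lt_succ_iff_lt_or_eq.mp hj with hj | hj
      · exact h1 j hj
      · rwa [show j = π.order.symm ⟨t, ht'⟩ from π.order.injective (by simp [Fin.ext_iff, hj])]
    · intro h
      exact ⟨fun j hj => h j (hj.trans t.lt_succ_self), h _ (by simp)⟩

/-- The left napkin of place `j` is gone when the guest at place `j` sits down. -/
def SignedPerm.leftGone (j : Fin (N + 1)) : Prop := j ∉ π.onTable (π.order j)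

/-- The right napkin of place `j` is gone when the guest at place `j` sits down. -/
def SignedPerm.rightGone (j : Fin (N + 1)) : Prop := j + 1 ∉ π.onTable (π.order j)

theorem SignedPerm.napkinOf_eq_none_iff (j : Fin (N + 1)) :
    π.napkinOf j = none ↔ π.leftGone j ∧ π.rightGone j := by
  simp only [napkinOf, take, preferred, other, leftGone, rightGone, leftNapkin, rightNapkin_eq]
  cases π.sign j <;> simp only [Bool.false_eq_true, if_true, if_false] <;> split_ifs <;> simp_all

theorem SignedPerm.eq_or_eq_of_napkinOf {j c : Fin (N + 1)} (h : π.napkinOf j = some c) :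
    c = j ∨ c = j + 1 := by
  simp only [napkinOf, take, preferred, other, leftNapkin, rightNapkin_eq] at h
  split_ifs at h <;> simp_all

theorem SignedPerm.leftGone_iff_napkinOf (j : Fin (N + 1)) :
    π.leftGone (j + 1) ↔ π.order j < π.order (j + 1) ∧ π.napkinOf j = some (j + 1) := by
  rw [leftGone, π.mem_onTable_iff _ (π.order _).isLt.le]
  push Not
  constructor
  · rintro ⟨k, hk, hc⟩
    rcases π.eq_or_eq_of_napkinOf hc with h | h
    · subst h; exact absurd hk (lt_irrefl _)
    · obtain rfl := add_right_cancel h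
      exact ⟨hk, hc⟩
  · rintro ⟨h1, h2⟩
    exact ⟨j, h1, h2⟩

theorem SignedPerm.rightGone_iff_napkinOf (j : Fin (N + 1)) :
    π.rightGone j ↔ π.order (j + 1) < π.order j ∧ π.napkinOf (j + 1) = some (j + 1) := by
  rw [rightGone, π.mem_onTable_iff _ (π.order _).isLt.le]
  push Not
  constructor
  · rintro ⟨k, hk, hc⟩
    rcases π.eq_or_eq_of_napkinOf hc with h | h
    · subst h; exact ⟨hk, hc⟩
    · obtain rfl := add_right_cancel h
      exact absurd hk (lt_irrefl _)
  · rintro ⟨h1, h2⟩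
    exact ⟨j + 1, h1, h2⟩

theorem SignedPerm.leftGone_succ_iff (j : Fin (N + 1)) :
    π.leftGone (j + 1) ↔ π.order j < π.order (j + 1) ∧ (π.sign j = true ∨ π.leftGone j) := by
  rw [leftGone_iff_napkinOf, and_congr_right_iff]
  intro hlt
  have hne : j ≠ j + 1 := fun h => hlt.ne (congrArg _ h)
  -- Only the neighbour at `j + 1` could have removed this napkin beforehand, and he sits down
  -- later. So the guest at `j` takes it unless he prefers left and finds his left napkin.
  have hr : j + 1 ∈ π.onTable (π.order j) := by
    by_contra h
    exact lt_asymm hlt ((π.rightGone_iff_napkinOf j).mp h).1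
  simp only [napkinOf, take, preferred, other, leftGone, leftNapkin, rightNapkin_eq]
  cases π.sign j <;> simp [hr, hne]

theorem SignedPerm.rightGone_iff (j : Fin (N + 1)) :
    π.rightGone j ↔
      π.order (j + 1) < π.order j ∧ (π.sign (j + 1) = false ∨ π.rightGone (j + 1)) := by
  rw [rightGone_iff_napkinOf, and_congr_right_iff]
  intro hlt
  have hne : j + 1 ≠ j + 1 + 1 := fun h => hlt.ne' (congrArg _ (add_right_cancel h))
  have hl : j + 1 ∈ π.onTable (π.order (j + 1)) := by
    by_contra h
    exact lt_asymm hlt ((π.leftGone_iff_napkinOf j).mp h).1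
  simp only [napkinOf, take, preferred, other, rightGone, leftNapkin, rightNapkin_eq]
  cases π.sign (j + 1) <;> simp [hl, hne.symm]

/-- Walking from place `i` in direction `e`, one meets guests who sat down earlier and earlier;
the `k`-th of them has sign `b` and those before him have the opposite sign. -/
structure SignedPerm.IsChain (e : Fin (N + 1)) (b : Bool) (i : Fin (N + 1)) (k : ℕ) : Prop where
  pos : 1 ≤ k
  last : π.sign (i + k • e) = b
  inner : ∀ m, 1 ≤ m → m < k → π.sign (i + m • e) = !b
  desc : ∀ m < k, π.order (i + (m + 1) • e) < π.order (i + m • e)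

variable {π}

/-- The length is the first distance at which sign `b` occurs. -/
theorem SignedPerm.IsChain.unique {e i : Fin (N + 1)} {b : Bool} {k l : ℕ}
    (hk : π.IsChain e b i k) (hl : π.IsChain e b i l) : k = l := by
  rcases lt_trichotomy k l with h | h | h
  · have := hl.inner k hk.pos h
    rw [hk.last] at this
    simp at this
  · exact h
  · have := hk.inner l hl.pos h
    rw [hl.last] at this
    simp at this

theorem SignedPerm.IsChain.order_add_le {e i : Fin (N + 1)} {b : Bool} {k : ℕ}
    (hk : π.IsChain e b i k) (m : ℕ) (hm : m ≤ k) :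
    (π.order (i + m • e) : ℕ) + m ≤ π.order i := by
  induction m with
  | zero => simp
  | succ m ih =>
    have h1 := ih (by omega)
    have h2 : (π.order (i + (m + 1) • e) : ℕ) < π.order (i + m • e) := hk.desc m hm
    omega

theorem SignedPerm.IsChain.lt {e i : Fin (N + 1)} {b : Bool} {k : ℕ}
    (hk : π.IsChain e b i k) : k < N + 1 := by
  have := hk.order_add_le k le_rfl
  have := (π.order i).isLt
  omega

theorem SignedPerm.isChain_succ_iff {e i : Fin (N + 1)} {b : Bool} {k : ℕ} (hk : 1 ≤ k) :
    π.IsChain e b i (k + 1) ↔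
      π.order (i + e) < π.order i ∧ π.sign (i + e) = !b ∧ π.IsChain e b (i + e) k := by
  have hs : ∀ m : ℕ, i + (m + 1) • e = i + e + m • e := fun m => by
    rw [succ_nsmul]; abel
  constructor
  · rintro ⟨_, h2, h3, h4⟩
    refine ⟨by simpa using h4 0 (by omega), by simpa using h3 1 le_rfl (by omega), hk, ?_, ?_, ?_⟩
    · rw [← hs]; exact h2
    · intro m hm1 hm2
      rw [← hs]; exact h3 _ (by omega) (by omega)
    · intro m hm
      rw [← hs, ← hs]; exact h4 _ (by omega)
  · rintro ⟨h1, h2, h3⟩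
    refine ⟨by omega, ?_, ?_, ?_⟩
    · rw [hs]; exact h3.last
    · rintro (_ | _ | m) hm1 hm2
      · omega
      · simpa using h2
      · rw [hs]; exact h3.inner _ (by omega) (by omega)
    · rintro (_ | m) hm
      · simpa using h1
      · rw [hs, hs]; exact h3.desc _ (by omega)

theorem SignedPerm.isChain_one_iff {e i : Fin (N + 1)} {b : Bool} :
    π.IsChain e b i 1 ↔ π.order (i + e) < π.order i ∧ π.sign (i + e) = b := by
  constructor
  · intro h
    exact ⟨by simpa using h.desc 0 one_pos, by simpa using h.last⟩
  · rintro ⟨h1, h2⟩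
    refine ⟨le_rfl, by simpa using h2, fun m _ _ => by omega, fun m hm => ?_⟩
    obtain rfl : m = 0 := by omega
    simpa using h1

/-- A predicate on the places that propagates along a chain holds exactly at starts of chains. -/
theorem SignedPerm.iff_exists_isChain {e : Fin (N + 1)} {b : Bool} {T : Fin (N + 1) → Prop}
    (hT : ∀ j, T j ↔ π.order (j + e) < π.order j ∧ (π.sign (j + e) = b ∨ T (j + e)))
    (i : Fin (N + 1)) : T i ↔ ∃ k, π.IsChain e b i k := by
  induction h : π.order i using WellFoundedLT.induction generalizing i with
  | ind t ih =>
    subst h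
    rw [hT]
    constructor
    · rintro ⟨hlt, h⟩
      by_cases hs : π.sign (i + e) = b
      · exact ⟨1, isChain_one_iff.mpr ⟨hlt, hs⟩⟩
      · obtain ⟨k, hk⟩ := (ih _ hlt _ rfl).mp (h.resolve_left hs)
        exact ⟨k + 1, (isChain_succ_iff hk.pos).mpr ⟨hlt, by simpa [← Bool.not_eq] using hs, hk⟩⟩
    · rintro ⟨k, hk⟩
      rcases k with _ | _ | k
      · exact absurd hk.pos (by simp)
      · obtain ⟨h1, h2⟩ := isChain_one_iff.mp hk
        exact ⟨h1, Or.inl h2⟩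
      · obtain ⟨h1, -, h3⟩ := (isChain_succ_iff (by omega)).mp hk
        exact ⟨h1, Or.inr ((ih _ h1 _ rfl).mpr ⟨_, h3⟩)⟩

theorem SignedPerm.napkinOf_eq_none_iff_isChain (i : Fin (N + 1)) :
    π.napkinOf i = none ↔ ∃ k l, π.IsChain (-1) true i k ∧ π.IsChain 1 false i l := by
  have hl := iff_exists_isChain (π := π) (e := -1) (b := true) (T := π.leftGone)
    (fun j => by simpa using π.leftGone_succ_iff (j + -1)) i
  have hr := iff_exists_isChain (π := π) (e := 1) (b := false) (T := π.rightGone)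
    (fun j => π.rightGone_iff j) i
  rw [napkinOf_eq_none_iff, hl, hr]
  constructor
  · rintro ⟨⟨k, hk⟩, l, hl⟩; exact ⟨k, l, hk, hl⟩
  · rintro ⟨k, l, hk, hl⟩; exact ⟨⟨k, hk⟩, l, hl⟩

theorem nsmul_card_fin (x : Fin (N + 1)) : (N + 1) • x = 0 := by
  simpa using card_nsmul_eq_zero (x := x)

theorem add_nsmul_neg_one {m m' : ℕ} (h : m + m' = N + 1) (i : Fin (N + 1)) :
    i + m • (-1 : Fin (N + 1)) = i + m' • (1 : Fin (N + 1)) := by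
  have : (m + m') • (1 : Fin (N + 1)) = 0 := by simpa only [h] using nsmul_card_fin 1
  rw [add_nsmul] at this
  rw [smul_neg, add_right_inj, neg_eq_iff_add_eq_zero, this]

/-- Otherwise the arms meet around the table. If they share only their far end, that guest would
need both signs; if they overlap further, the last step of the left arm is also a step of the right
arm, taken in the opposite direction, and the two order relations conflict. -/
theorem SignedPerm.IsChain.add_lt {i : Fin (N + 1)} {k l : ℕ}
    (hk : π.IsChain (-1) true i k) (hl : π.IsChain 1 false i l) : k + l < N + 1 := by
  by_contra! hc
  have hkN := hk.lt
  have hlN := hl.lt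
  have hkp := hk.pos
  have h1 := hk.last
  rw [add_nsmul_neg_one (m' := N + 1 - k) (by omega)] at h1
  have hne : N + 1 - k ≠ l := by
    intro h
    rw [h, hl.last] at h1
    simp at h1
  have hd := hl.desc (N + 1 - k) (by omega)
  have hd' := hk.desc (k - 1) (by omega)
  rw [add_nsmul_neg_one (m' := N + 1 - k) (by omega),
    add_nsmul_neg_one (m' := N + 1 - k + 1) (by omega)] at hd'
  exact lt_asymm hd hd'

/-- Since the pair of lengths is unique and has sum below `N + 1`, at most one term is nonzero. -/
theorem SignedPerm.indicator_napkinless (π : SignedPerm (N + 1)) (i : Fin (N + 1)) :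
    open Classical in
    (if π.napkinOf i = none then (1 : ℝ) else 0) = ∑ m ∈ range (N + 1), ∑ x ∈ antidiagonal m,
      if π.IsChain (-1) true i x.1 ∧ π.IsChain 1 false i x.2 then 1 else 0 := by
  classical
  split_ifs with h
  · obtain ⟨k, l, hk, hl⟩ := (napkinOf_eq_none_iff_isChain i).mp h
    rw [sum_eq_single_of_mem (k + l) (mem_range.mpr (hk.add_lt hl)),
      sum_eq_single_of_mem (k, l) (mem_antidiagonal.mpr rfl), if_pos ⟨hk, hl⟩]
    · rintro ⟨a, b⟩ - hne
      refine if_neg fun hab => hne ?_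
      exact Prod.ext (hab.1.unique hk) (hab.2.unique hl)
    · intro m _ hne
      refine sum_eq_zero fun x hx => if_neg fun hab => hne ?_
      rw [← mem_antidiagonal.mp hx, hab.1.unique hk, hab.2.unique hl]
  · refine (sum_eq_zero fun m _ => sum_eq_zero fun x _ => if_neg fun hab => h ?_).symm
    exact (napkinOf_eq_none_iff_isChain i).mpr ⟨_, _, hab⟩

end Dynamics

/-! ### Probability of a pair of chains, and the expectation -/

section Expectation

variable {N : ℕ}

theorem val_nsmul_one_fin (m : ℕ) : (m • (1 : Fin (N + 1))).val = m % (N + 1) := by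
  induction m with
  | zero => simp
  | succ m ih => rw [succ_nsmul, Fin.val_add, ih]; simp

theorem add_nsmul_one_injOn (i : Fin (N + 1)) :
    Set.InjOn (fun m : ℕ => i + m • (1 : Fin (N + 1))) (range (N + 1)) := by
  intro a ha b hb h
  simp only [add_right_inj] at h
  have h' := congrArg Fin.val h
  rw [coe_range, Set.mem_Iio] at ha hb
  rwa [val_nsmul_one_fin, val_nsmul_one_fin, Nat.mod_eq_of_lt ha, Nat.mod_eq_of_lt hb] at h'

/-- Separates "the start is largest" from "the rest decreases", the two events counted independently
in `card_desc_mul`. -/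
theorem forall_succ_lt_iff {α : Type*} [Preorder α] (f : ℕ → α) (k : ℕ) :
    (∀ m < k, f (m + 1) < f m) ↔
      (∀ m : Fin k, f (m + 1) < f 0) ∧ StrictAnti fun m : Fin k => f (m + 1) := by
  constructor
  · intro h
    have hlt : ∀ b ≤ k, ∀ a < b, f b < f a := by
      intro b
      induction b with
      | zero => intro _ a ha; omega
      | succ b ih =>
        intro hb a ha
        rcases Nat.lt_succ_iff_lt_or_eq.mp ha with ha | rfl
        · exact (h b hb).trans (ih (by omega) a ha)
        · exact h a hb
    exact ⟨fun m => hlt _ m.isLt _ (by omega),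
      fun a b hab => hlt _ b.isLt _ (Nat.succ_lt_succ hab)⟩
  · rintro ⟨h0, h1⟩ (_ | m) hm
    · exact h0 ⟨0, hm⟩
    · exact h1 (a := ⟨m, by omega⟩) (b := ⟨m + 1, hm⟩) (Fin.mk_lt_mk.mpr m.lt_succ_self)

/-- The number of seating orders in which the `k` guests to the left and the `l` guests to the
right of place `i` sit down in the order of decreasing distance to `i`, and before the
guest at `i`. -/
theorem card_desc_mul (i : Fin (N + 1)) {k l : ℕ} (hkl : k + l < N + 1) :
    #{σ : Equiv.Perm (Fin (N + 1)) |
      (∀ m < k, σ (i + (m + 1) • (-1)) < σ (i + m • (-1))) ∧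
        ∀ m < l, σ (i + (m + 1) • 1) < σ (i + m • 1)} * (k ! * l ! * (k + l + 1)) =
      (N + 1)! := by
  set c : ℕ → Fin (N + 1) := fun m => i + m • 1 with hc
  have hinj := add_nsmul_one_injOn i
  have hinj' : ∀ a b, a < N + 1 → b < N + 1 → c a = c b → a = b := fun a b ha hb h =>
    hinj (by simpa using ha) (by simpa using hb) h
  have hneg : ∀ m ≤ N + 1, i + m • (-1) = c (N + 1 - m) := fun m hm =>
    add_nsmul_neg_one (by omega) i
  have hc0 : c 0 = i := by simp [hc]
  let vL : Fin k ↪ Fin (N + 1) :=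
    ⟨fun m => c (N + 1 - (m + 1)), fun a b h => by
      have := hinj' _ _ (by omega) (by omega) h
      omega⟩
  let vR : Fin l ↪ Fin (N + 1) :=
    ⟨fun m => c (m + 1), fun a b h => by
      have := hinj' _ _ (by omega) (by omega) h
      omega⟩
  -- Both arms together with `i`, all measured by offsets in the positive direction; `k + l < N + 1`
  -- makes these offsets distinct.
  let S : Finset (Fin (N + 1)) := (range (l + 1) ∪ Ico (N + 1 - k) (N + 1)).image c
  have hvL : ∀ m, vL m = c (N + 1 - (m + 1)) := fun _ => rfl
  have hvR : ∀ m, vR m = c (m + 1) := fun _ => rfl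
  have hiS : i ∈ S := mem_image.mpr ⟨0, by simp, hc0⟩
  have hLS : ∀ m, vL m ∈ S := fun m => mem_image.mpr ⟨_, by simp; omega, rfl⟩
  have hRS : ∀ m, vR m ∈ S := fun m => mem_image.mpr ⟨m + 1, by simp, rfl⟩
  have hS : ∀ x ∈ S, x = i ∨ x ∈ Set.range vL ∨ x ∈ Set.range vR := by
    intro x hx
    obtain ⟨m, hm, rfl⟩ := mem_image.mp hx
    simp only [mem_union, mem_range, mem_Ico] at hm
    rcases hm with hm | hm
    · rcases m with _ | m
      · exact Or.inl hc0
      · exact Or.inr (Or.inr ⟨⟨m, by omega⟩, rfl⟩)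
    · refine Or.inr (Or.inl ⟨⟨N - m, by omega⟩, ?_⟩)
      rw [hvL]
      congr 1
      simp only
      omega
  have hLi : ∀ m, vL m ≠ i := fun m h => by
    have := hinj' _ 0 (by omega) (by omega) (h.trans hc0.symm)
    omega
  have hRi : ∀ m, vR m ≠ i := fun m h => by
    have := hinj' _ 0 (by omega) (by omega) (h.trans hc0.symm)
    omega
  have hLR : ∀ a b, vL a ≠ vR b := fun a b h => by
    have := hinj' _ _ (by omega) (by omega) h
    omega
  have hcard : #S = k + l + 1 := by
    rw [card_image_of_injOn, card_union_of_disjoint]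
    · simp; omega
    · rw [Finset.disjoint_left]
      intro a ha hb
      simp only [mem_range, mem_Ico] at ha hb
      omega
    · refine hinj.mono fun a ha => ?_
      simp only [coe_union, coe_range, coe_Ico, Set.mem_union, Set.mem_Iio, Set.mem_Ico] at ha ⊢
      omega
  have hfix : ∀ τ : Equiv.Perm (Fin (N + 1)), ∀ x ∈ S, (∀ y ∉ S, τ y = y) → τ x ∈ S := by
    intro τ x hx h
    by_contra hn
    have := τ.injective (h _ hn)
    exact hn (by rwa [this])
  have hiff : ∀ σ : Equiv.Perm (Fin (N + 1)),
      ((∀ m < k, σ (i + (m + 1) • (-1)) < σ (i + m • (-1))) ∧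
        ∀ m < l, σ (i + (m + 1) • 1) < σ (i + m • 1)) ↔
      ((∀ x ∈ S, σ x ≤ σ i) ∧ StrictAnti (σ ∘ vL)) ∧ StrictAnti (σ ∘ vR) := by
    intro σ
    rw [forall_succ_lt_iff (fun m => σ (i + m • (-1))), forall_succ_lt_iff (fun m => σ (c m))]
    have e1 : ∀ m : Fin k, i + ((m : ℕ) + 1) • (-1) = vL m := fun m => hneg _ (by omega)
    have e2 : ∀ m : Fin l, c ((m : ℕ) + 1) = vR m := fun m => rfl
    simp only [e1, e2, zero_nsmul, add_zero, hc0]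
    have e3 : (∀ x ∈ S, σ x ≤ σ i) ↔ (∀ m, σ (vL m) < σ i) ∧ ∀ m, σ (vR m) < σ i := by
      constructor
      · intro h
        exact ⟨fun m => (h _ (hLS m)).lt_of_ne (σ.injective.ne (hLi m)),
          fun m => (h _ (hRS m)).lt_of_ne (σ.injective.ne (hRi m))⟩
      · rintro ⟨h1, h2⟩ x hx
        rcases hS x hx with rfl | ⟨m, rfl⟩ | ⟨m, rfl⟩
        · exact le_rfl
        · exact (h1 m).le
        · exact (h2 m).le
    rw [e3]
    simp only [Function.comp_def, StrictAnti]
    tauto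
  have hmax : ∀ σ τ : Equiv.Perm (Fin (N + 1)), (∀ y ∉ S, τ y = y) → τ i = i →
      (∀ x ∈ S, σ x ≤ σ i) → ∀ x ∈ S, (σ * τ) x ≤ (σ * τ) i := by
    intro σ τ hτ hi h x hx
    rw [Equiv.Perm.mul_apply, Equiv.Perm.mul_apply, hi]
    exact h _ (hfix τ x hx hτ)
  -- The conditions are peeled off in turn: permuting the right arm affects neither the maximum on
  -- `S` nor the order along the left arm, and permuting the left arm does not affect the maximum.
  have hR := card_strictAnti_mul_factorial vR
    (fun σ => (∀ x ∈ S, σ x ≤ σ i) ∧ StrictAnti (σ ∘ vL)) (by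
      rintro σ τ hτ ⟨h1, h2⟩
      refine ⟨hmax σ τ (fun y hy => hτ y ?_) (hτ i ?_) h1, ?_⟩
      · rintro ⟨m, rfl⟩; exact hy (hRS m)
      · rintro ⟨m, hm⟩; exact hRi m hm
      · convert h2 using 1
        funext m
        have : τ (vL m) = vL m := hτ _ (by rintro ⟨b, hb⟩; exact hLR m b hb.symm)
        simp [this])
  have hL := card_strictAnti_mul_factorial vL (fun σ => ∀ x ∈ S, σ x ≤ σ i) (by
      intro σ τ hτ h1
      refine hmax σ τ (fun y hy => hτ y ?_) (hτ i ?_) h1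
      · rintro ⟨m, rfl⟩; exact hy (hLS m)
      · rintro ⟨m, hm⟩; exact hLi m hm)
  have hM := card_isMax_mul_card hiS
  rw [hcard] at hM
  rw [filter_congr fun σ _ => hiff σ, ← hM, ← hL, ← hR]
  ring

/-- The total weight of the sign vectors that occur in chains of lengths `k` and `l`. -/
theorem sum_sign_chain {p q : ℝ} (hpq : p + q = 1) (i : Fin (N + 1)) {k l : ℕ}
    (hk : 1 ≤ k) (hl : 1 ≤ l) (hkl : k + l < N + 1) :
    ∑ s : Fin (N + 1) → Bool,
      (if (s (i + k • (-1)) = true ∧ ∀ m, 1 ≤ m → m < k → s (i + m • (-1)) = false) ∧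
          (s (i + l • 1) = false ∧ ∀ m, 1 ≤ m → m < l → s (i + m • 1) = true) then
        p ^ #{i | s i = false} * q ^ #{i | s i = true} else 0) = p ^ k * q ^ l := by
  set c : ℕ → Fin (N + 1) := fun m => i + m • 1 with hc
  have hinj := add_nsmul_one_injOn i
  have hneg : ∀ m ≤ N + 1, i + m • (-1) = c (N + 1 - m) := fun m hm =>
    add_nsmul_neg_one (by omega) i
  -- `A₀` and `B₀` hold the offsets of the forced minus and plus signs. Each pairs the interior of
  -- one arm with the far end of the other, so the sizes are `(k - 1) + 1` and `(l - 1) + 1`.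
  let A₀ : Finset ℕ := insert l (Ioo (N + 1 - k) (N + 1))
  let B₀ : Finset ℕ := insert (N + 1 - k) (Ico 1 l)
  have hA₀ : A₀ ⊆ range (N + 1) := by
    intro a ha
    simp only [A₀, mem_insert, mem_Ioo, mem_range] at ha ⊢
    omega
  have hB₀ : B₀ ⊆ range (N + 1) := by
    intro a ha
    simp only [B₀, mem_insert, mem_Ico, mem_range] at ha ⊢
    omega
  have hcA : #(A₀.image c) = k := by
    rw [card_image_of_injOn (hinj.mono (coe_subset.mpr hA₀)), card_insert_of_notMem]
    · simp; omega
    · simp; omega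
  have hcB : #(B₀.image c) = l := by
    rw [card_image_of_injOn (hinj.mono (coe_subset.mpr hB₀)), card_insert_of_notMem]
    · simp; omega
    · simp; omega
  have hdisj : Disjoint (A₀.image c) (B₀.image c) := by
    rw [Finset.disjoint_left]
    intro x ha hb
    obtain ⟨a, ha', rfl⟩ := mem_image.mp ha
    obtain ⟨b, hb', hab⟩ := mem_image.mp hb
    have := hinj (hB₀ hb') (hA₀ ha') hab
    simp only [A₀, B₀, mem_insert, mem_Ioo, mem_Ico] at ha' hb'
    omega
  have h := sum_sign_weight p q hpq _ _ hdisj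
  rw [hcA, hcB] at h
  rw [← h]
  refine sum_congr rfl fun s _ => if_congr ?_ rfl rfl
  simp only [A₀, B₀, forall_mem_image, mem_insert, forall_eq_or_imp, mem_Ioo, mem_Ico]
  rw [hneg k (by omega)]
  have hinner : (∀ m, 1 ≤ m → m < k → s (i + m • (-1)) = false) ↔
      ∀ a, N + 1 - k < a ∧ a < N + 1 → s (c a) = false := by
    constructor
    · rintro h a ⟨h1, h2⟩
      have := h (N + 1 - a) (by omega) (by omega)
      rwa [hneg _ (by omega), show N + 1 - (N + 1 - a) = a by omega] at this
    · intro h m h1 h2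
      rw [hneg _ (by omega)]
      exact h _ ⟨by omega, by omega⟩
  rw [hinner]
  simp only [and_imp, hc]
  tauto

/-- The probability of the conjunction of an event about the seating order and an event about
the preferences. -/
theorem sum_weight_of_iff {n : ℕ} (p q : ℝ) (O : Equiv.Perm (Fin n) → Prop)
    (G : (Fin n → Bool) → Prop) (E : SignedPerm n → Prop) [DecidablePred O] [DecidablePred G]
    [DecidablePred E] (h : ∀ π, E π ↔ O π.order ∧ G π.sign) :
    ∑ π : SignedPerm n, p ^ π.numNeg * q ^ π.numPos / (n ! : ℝ) * (if E π then 1 else 0) =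
      #{σ | O σ} * (∑ s, if G s then p ^ #{i | s i = false} * q ^ #{i | s i = true} else 0) /
        (n ! : ℝ) := by
  rw [card_filter, Nat.cast_sum, sum_mul_sum, ← Fintype.sum_prod_type', sum_div,
    ← (SignedPerm.equivProd n).sum_comp]
  refine sum_congr rfl fun π _ => ?_
  simp only [SignedPerm.equivProd, Equiv.coe_fn_mk, SignedPerm.numNeg, SignedPerm.numPos]
  by_cases h1 : O π.order <;> by_cases h2 : G π.sign <;> simp [h, h1, h2]
  rfl

open Classical in
theorem sum_weight_isChain {p q : ℝ} (hpq : p + q = 1) (i : Fin (N + 1)) {k l : ℕ}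
    (hkl : k + l < N + 1) :
    ∑ π : SignedPerm (N + 1), p ^ π.numNeg * q ^ π.numPos / ((N + 1)! : ℝ) *
      (if π.IsChain (-1) true i k ∧ π.IsChain 1 false i l then 1 else 0) =
    if 1 ≤ k ∧ 1 ≤ l then p ^ k * q ^ l / ((((k + l : ℕ) : ℝ) + 1) * k ! * l !) else 0 := by
  split_ifs with h
  swap
  · exact sum_eq_zero fun π _ => by rw [if_neg fun hc => h ⟨hc.1.pos, hc.2.pos⟩, mul_zero]
  obtain ⟨hk, hl⟩ := h
  have hiff : ∀ π : SignedPerm (N + 1), (π.IsChain (-1) true i k ∧ π.IsChain 1 false i l) ↔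
      ((∀ m < k, π.order (i + (m + 1) • (-1)) < π.order (i + m • (-1))) ∧
        ∀ m < l, π.order (i + (m + 1) • 1) < π.order (i + m • 1)) ∧
      ((π.sign (i + k • (-1)) = true ∧ ∀ m, 1 ≤ m → m < k → π.sign (i + m • (-1)) = false) ∧
        (π.sign (i + l • 1) = false ∧ ∀ m, 1 ≤ m → m < l → π.sign (i + m • 1) = true)) := by
    intro π
    constructor
    · rintro ⟨h1, h2⟩
      exact ⟨⟨h1.desc, h2.desc⟩, ⟨h1.last, h1.inner⟩, h2.last, h2.inner⟩
    · rintro ⟨⟨h1, h2⟩, ⟨h3, h4⟩, h5, h6⟩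
      exact ⟨⟨hk, h3, h4, h1⟩, hl, h5, h6, h2⟩
  rw [sum_weight_of_iff p q
    (fun σ => (∀ m < k, σ (i + (m + 1) • (-1)) < σ (i + m • (-1))) ∧
      ∀ m < l, σ (i + (m + 1) • 1) < σ (i + m • 1))
    (fun s => (s (i + k • (-1)) = true ∧ ∀ m, 1 ≤ m → m < k → s (i + m • (-1)) = false) ∧
      (s (i + l • 1) = false ∧ ∀ m, 1 ≤ m → m < l → s (i + m • 1) = true)) _ hiff]
  have hcard := congrArg (Nat.cast (R := ℝ)) (card_desc_mul i hkl)
  have hsign := sum_sign_chain hpq i hk hl hkl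
  have hne : ((N + 1)! : ℝ) ≠ 0 := by positivity
  rw [div_eq_div_iff hne (by positivity), ← hcard, ← hsign]
  push_cast
  ring_nf

theorem expectedNapkinless_eq {p q : ℝ} (hpq : p + q = 1) {n : ℕ} (hn : 1 ≤ n) :
    expectedNapkinless p q n =
      n * ∑ m ∈ range n, (1 - p ^ m - q ^ m + if m = 0 then 1 else 0) / ((m + 1)! : ℝ) := by
  classical
  obtain ⟨N, rfl⟩ : ∃ N, n = N + 1 := ⟨n - 1, by omega⟩
  have h1 : ∀ π : SignedPerm (N + 1), (π.numNapkinless : ℝ) =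
      ∑ i, ∑ m ∈ range (N + 1), ∑ x ∈ antidiagonal m,
        if π.IsChain (-1) true i x.1 ∧ π.IsChain 1 false i x.2 then 1 else 0 := by
    intro π
    rw [SignedPerm.numNapkinless, card_filter, Nat.cast_sum]
    refine sum_congr rfl fun i _ => ?_
    rw [← π.indicator_napkinless i]
    split_ifs <;> simp
  simp only [expectedNapkinless, h1, mul_sum]
  rw [sum_comm]
  trans ∑ i : Fin (N + 1), ∑ m ∈ range (N + 1),
    (1 - p ^ m - q ^ m + if m = 0 then 1 else 0) / ((m + 1)! : ℝ)
  · refine sum_congr rfl fun i _ => ?_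
    rw [sum_comm]
    -- The contribution of each `m` does not depend on the place `i`, which is where the factor `n`
    -- comes from.
    refine sum_congr rfl fun m hm => ?_
    rw [sum_comm, ← sum_antidiagonal_pos hpq]
    refine sum_congr rfl fun x hx => ?_
    rw [HasAntidiagonal.mem_antidiagonal] at hx
    rw [sum_weight_isChain hpq i (by rw [hx]; exact mem_range.mp hm), hx]
  · rw [sum_const, card_univ, Fintype.card_fin, nsmul_eq_mul, mul_sum]

end Expectation
end NapkinProblem

theorem mainTheorem6 :
    (∃ C : ℝ, ∀ p q : ℝ, 0 < p → 0 < q → p + q = 1 → ∀ n : ℕ, 1 ≤ n →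
      |NapkinProblem.expectedNapkinless p q n -
          (n : ℝ) * (1 - p * Real.exp q) * (1 - q * Real.exp p) / (p * q)| ≤ C / (n ! : ℝ)) ∧
    (∃ C : ℝ, ∀ n : ℕ, 1 ≤ n →
      |NapkinProblem.expectedNapkinless (1 / 2) (1 / 2) n -
          (n : ℝ) * (2 - Real.sqrt (Real.exp 1)) ^ 2| ≤ C / (n ! : ℝ)) := by
  have hmain : ∀ p q : ℝ, 0 < p → 0 < q → p + q = 1 → ∀ n : ℕ, 1 ≤ n →
      |NapkinProblem.expectedNapkinless p q n -
        (n : ℝ) * (1 - p * Real.exp q) * (1 - q * Real.exp p) / (p * q)| ≤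
      Real.exp 1 / (n ! : ℝ) := by
    intro p q hp hq hpq n hn
    rw [NapkinProblem.expectedNapkinless_eq hpq hn]
    exact NapkinProblem.napkin_series_bound hp hq hpq n
  refine ⟨⟨Real.exp 1, hmain⟩, Real.exp 1, fun n hn => ?_⟩
  convert hmain (1 / 2) (1 / 2) (by norm_num) (by norm_num) (by norm_num) n hn using 3
  rw [← Real.exp_half]
  ring
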